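/- Let $d\ge 1$, $\sigma>0$, and let $K(x,y)=\exp\!\big(-\|x-y\|^2/(2\sigma^2)\big)$ be the Gaussian kernel on $\mathbb{R}^d$, with kernel distance $D_K(x,y)=\sqrt{K(x,x)+K(y,y)-2K(x,y)}$. For $t\in\mathbb{N}$ let $\omega_1,\dots,\omega_t$ be independent random vectors with law $\mathcal N_d(0,\sigma^{-2}I_d)$, and let $\hat\phi:\mathbb{R}^d\to\mathbb{R}^{2t}$ be the random Fourier feature map $$\hat\phi(x)=\tfrac{1}{\sqrt t}\big(\cos\langle\omega_i,x\rangle,\ \sin\langle\omega_i,x\rangle\big)_{i=1}^t .$$ Put $\hat K(x,y)=\langle\hat\phi(x),\hat\phi(y)\rangle$ and $D_{\hat K}(x,y)=\sqrt{\hat K(x,x)+\hat K(y,y)-2\hat K(x,y)}=\|\hat\phi(x)-\hat\phi(y)\|$. Both distances depend on $x,y$ only through $\Delta=(x-y)/\sigma$, and one writes $D_K(\Delta)=D_K(x,y)$ and $D_{\hat K}(\Delta)=D_{\hat K}(x,y)$. There is an absolute constant $C>0$ such that for all $d\ge 1$, $\sigma>0$, $\varepsilon\in(0,1)$, $\delta\in(0,1)$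 and every integer $$t\ \ge\ C\,\frac{d}{\varepsilon^2}\,\log\!\Big(\frac{d}{\varepsilon}\cdot\frac1\delta\Big),$$ with probability at least $1-\delta$ the following holds simultaneously for all $\Delta\in\mathbb{R}^d$ with $0<\|\Delta\|\le 1$ (equivalently, for all $x\ne y$ in $\mathbb{R}^d$ with $\|x-y\|\le\sigma$): $$\frac{D_{\hat K}(\Delta)}{D_K(\Delta)}\in[1-\varepsilon,\,1+\varepsilon].$$ -/

import Mathlib

/-- The Gaussian kernel with bandwidth `σ` on `ℝᵈ`. -/
noncomputable def gaussianKernel {d : ℕ} (σ : ℝ) (x y : EuclideanSpace ℝ (Fin d)) : ℝ :=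
  Real.exp (-(‖x - y‖ ^ 2 / (2 * σ ^ 2)))

/-- The distance induced by a kernel `k`. -/
noncomputable def kernelDist {α : Type*} (k : α → α → ℝ) (x y : α) : ℝ :=
  Real.sqrt (k x x + k y y - 2 * k x y)

/-- The feature pair at frequency `w`: the vector `(cos ⟨w, x⟩, sin ⟨w, x⟩)`. -/
noncomputable def featurePair {d : ℕ} (w x : EuclideanSpace ℝ (Fin d)) :
    EuclideanSpace ℝ (Fin 2) :=
  !₂[Real.cos (inner ℝ w x), Real.sin (inner ℝ w x)]

/-- The random Fourier feature map into `ℝ²ᵗ` with frequencies `w₁, …, wₜ`: the concatenation of the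
`t` feature pairs, scaled by `1 / √t`. -/
noncomputable def featureMap {d t : ℕ} (w : Fin t → EuclideanSpace ℝ (Fin d))
    (x : EuclideanSpace ℝ (Fin d)) : EuclideanSpace ℝ (Fin t × Fin 2) :=
  WithLp.toLp 2 fun p => featurePair (w p.1) x p.2 / Real.sqrt t

/-- The kernel induced by the random Fourier feature map. -/
noncomputable def featureKernel {d t : ℕ} (w : Fin t → EuclideanSpace ℝ (Fin d))
    (x y : EuclideanSpace ℝ (Fin d)) : ℝ :=
  inner ℝ (featureMap w x) (featureMap w y)

open MeasureTheory ProbabilityTheory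

/-! Write Δ = r u with 0 < r ≤ 1 and ‖u‖ = 1, and let g i = σ w i, a standard Gaussian vector.
Divided by 2r², the squared feature distance is the average over i of `chordQuotient r ⟨u, g i⟩`,
and the squared kernel distance is its expectation `gaussQuotient r`, which lies in [3/8, 1/2]. A
relative error in the ratio therefore reduces to a uniform additive error of order ε for these
averages.

The division by r² is harmless as r → 0: the chord quotient equals (s sinc(rs/2))²/2, so it is at
most s²/2 and is Lipschitz in (r, u) with a constant controlled by 1 + ‖g‖⁴, uniformly in r
(`abs_chordQuotient_sub_le`). Being dominated by s², the centred summands are subexponential, and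
Chernoff gives a tail exp(-tη²/256) at each fixed (r, u). A net of (r, u) with poly(d/(εδ))^(d+1)
points, a union bound over it, and Markov's inequality for the random Lipschitz constant give
uniformity (`measureReal_not_uniformlyClose_le`).

This needs d/(εδ) ≥ 2, since otherwise the logarithm may be too small to absorb numerical constants.
In the remaining range d = 1 and ε, δ ≥ 1/2. Large t follows from the case ε = δ = 1/2. For bounded
t, the hypothesis forces log(1/(εδ)), hence 1 - δ, to be so small that the positive probability of
all frequencies falling in a good interval suffices. -/

/-- The squared chord `|1 - e^{irs}|² / (2 r²)`: the normalised one-frequency feature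
distance at radius `r` in a direction along which the frequency has component `s`. -/
noncomputable def chordQuotient (r s : ℝ) : ℝ := (1 - Real.cos (r * s)) / r ^ 2

/-- The normalised Gaussian kernel distance at radius `r`. -/
noncomputable def gaussQuotient (r : ℝ) : ℝ := (1 - Real.exp (-(r ^ 2 / 2))) / r ^ 2

/-! ### Regularity of the chord quotient, uniform down to radius zero -/

theorem sinc_eq_integral_cos (x : ℝ) : Real.sinc x = ∫ τ in (0 : ℝ)..1, Real.cos (τ * x) := by
  rcases eq_or_ne x 0 with rfl | hx
  · simp
  · rw [intervalIntegral.integral_comp_mul_right _ hx, Real.sinc_of_ne_zero hx]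
    simp [div_eq_inv_mul]

theorem abs_cos_sub_cos_le (x y : ℝ) : |Real.cos x - Real.cos y| ≤ |x - y| := by
  have h := Convex.norm_image_sub_le_of_norm_deriv_le (f := Real.cos) (s := Set.univ) (C := 1)
    (x := y) (y := x) (fun _ _ => Real.differentiable_cos _)
    (fun z _ => by simpa using Real.abs_sin_le_one z) convex_univ trivial trivial
  simpa [Real.norm_eq_abs] using h

theorem abs_sinc_sub_sinc_le (x y : ℝ) : |Real.sinc x - Real.sinc y| ≤ |x - y| := by
  rw [sinc_eq_integral_cos, sinc_eq_integral_cos, ← intervalIntegral.integral_sub]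
  · have := intervalIntegral.norm_integral_le_of_norm_le_const (a := (0 : ℝ)) (b := 1)
      (f := fun τ => Real.cos (τ * x) - Real.cos (τ * y)) (C := |x - y|) ?_
    · simpa [Real.norm_eq_abs] using this
    · intro τ hτ
      rw [Set.uIoc_of_le zero_le_one] at hτ
      refine (abs_cos_sub_cos_le _ _).trans ?_
      rw [← mul_sub, abs_mul, abs_of_pos hτ.1]
      exact mul_le_of_le_one_left (abs_nonneg _) hτ.2
  · exact Continuous.intervalIntegrable (by fun_prop) _ _
  · exact Continuous.intervalIntegrable (by fun_prop) _ _

theorem chordQuotient_eq {r : ℝ} (hr : r ≠ 0) (s : ℝ) :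
    chordQuotient r s = (s * Real.sinc (r * s / 2)) ^ 2 / 2 := by
  have h : 1 - Real.cos (r * s) = 2 * Real.sin (r * s / 2) ^ 2 := by
    have := Real.cos_sq' (r * s / 2)
    have h2 := Real.cos_two_mul (r * s / 2)
    rw [mul_div_cancel₀ _ (two_ne_zero' ℝ)] at h2
    linarith
  rw [chordQuotient, h]
  rcases eq_or_ne s 0 with rfl | hs
  · simp
  · rw [Real.sinc_of_ne_zero (by positivity)]
    field_simp

theorem chordQuotient_nonneg (r s : ℝ) : 0 ≤ chordQuotient r s :=
  div_nonneg (sub_nonneg.2 (Real.cos_le_one _)) (sq_nonneg _)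

theorem chordQuotient_le {r : ℝ} (hr : r ≠ 0) (s : ℝ) : chordQuotient r s ≤ s ^ 2 / 2 := by
  have h : 0 < r ^ 2 := by positivity
  rw [chordQuotient, div_le_iff₀ h]
  nlinarith [Real.one_sub_sq_div_two_le_cos (x := r * s)]

theorem measurable_chordQuotient (r : ℝ) : Measurable (chordQuotient r) := by
  unfold chordQuotient
  fun_prop

/-- In the form p²/2 with p = s sinc(rs/2), no negative power of r appears. Since sinc is bounded by
1 and 1-Lipschitz, |p| ≤ A and p moves by at most η(A + A²). -/
theorem abs_chordQuotient_sub_le {r r' s s' A η : ℝ} (hr : 0 < r) (hr1 : r ≤ 1) (hr' : 0 < r')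
    (hs : |s| ≤ A) (hs' : |s'| ≤ A) (hη : 0 ≤ η) (hrr : |r - r'| ≤ η) (hss : |s - s'| ≤ η * A) :
    |chordQuotient r s - chordQuotient r' s'| ≤ 2 * η * (1 + A ^ 4) := by
  have hA : 0 ≤ A := (abs_nonneg s).trans hs
  set p := s * Real.sinc (r * s / 2) with hp
  set p' := s' * Real.sinc (r' * s' / 2) with hp'
  have hpA : |p| ≤ A := by
    rw [hp, abs_mul]
    exact (mul_le_of_le_one_right (abs_nonneg _) (Real.abs_sinc_le_one _)).trans hs
  have hpA' : |p'| ≤ A := by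
    rw [hp', abs_mul]
    exact (mul_le_of_le_one_right (abs_nonneg _) (Real.abs_sinc_le_one _)).trans hs'
  have harg : |r * s / 2 - r' * s' / 2| ≤ η * A := by
    have : r * s / 2 - r' * s' / 2 = (r * (s - s') + (r - r') * s') / 2 := by ring
    rw [this, abs_div, abs_two, div_le_iff₀ two_pos]
    refine (abs_add_le _ _).trans ?_
    rw [abs_mul, abs_mul, abs_of_pos hr]
    have h1 : r * |s - s'| ≤ η * A := (mul_le_of_le_one_left (abs_nonneg _) hr1).trans hss
    have h2 : |r - r'| * |s'| ≤ η * A := mul_le_mul hrr hs' (abs_nonneg _) hη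
    linarith
  have hpp : |p - p'| ≤ η * A + A * (η * A) := by
    have : p - p' = (s - s') * Real.sinc (r * s / 2)
        + s' * (Real.sinc (r * s / 2) - Real.sinc (r' * s' / 2)) := by rw [hp, hp']; ring
    rw [this]
    refine (abs_add_le _ _).trans (add_le_add ?_ ?_)
    · rw [abs_mul]
      exact (mul_le_of_le_one_right (abs_nonneg _) (Real.abs_sinc_le_one _)).trans hss
    · rw [abs_mul]
      exact mul_le_mul hs' ((abs_sinc_sub_sinc_le _ _).trans harg) (abs_nonneg _) hA
  rw [chordQuotient_eq hr.ne', chordQuotient_eq hr'.ne', ← hp, ← hp']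
  have h3 : p ^ 2 / 2 - p' ^ 2 / 2 = (p - p') * ((p + p') / 2) := by ring
  have h4 : |(p + p') / 2| ≤ A := by
    rw [abs_div, abs_two, div_le_iff₀ two_pos]
    linarith [abs_add_le p p']
  rw [h3, abs_mul]
  calc |p - p'| * |(p + p') / 2| ≤ (η * A + A * (η * A)) * A :=
        mul_le_mul hpp h4 (abs_nonneg _) (by positivity)
    _ = η * (A ^ 2 + A ^ 3) := by ring
    _ ≤ η * (2 * (1 + A ^ 4)) := by
        refine mul_le_mul_of_nonneg_left ?_ hη
        nlinarith [sq_nonneg (A ^ 2 - 1), sq_nonneg (A ^ 2 - A), sq_nonneg A]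
    _ = 2 * η * (1 + A ^ 4) := by ring

/-! ### Elementary inequalities -/

theorem gaussQuotient_le {r : ℝ} (hr : r ≠ 0) : gaussQuotient r ≤ 1 / 2 := by
  have h : 0 < r ^ 2 := by positivity
  rw [gaussQuotient, div_le_iff₀ h]
  linarith [Real.add_one_le_exp (-(r ^ 2 / 2))]

theorem le_gaussQuotient {r : ℝ} (hr : 0 < r) (hr1 : r ≤ 1) : 3 / 8 ≤ gaussQuotient r := by
  have h : 0 < r ^ 2 := by positivity
  have h1 : r ^ 2 ≤ 1 := pow_le_one₀ hr.le hr1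
  rw [gaussQuotient, le_div_iff₀ h]
  have hx : 0 ≤ r ^ 2 / 2 := by positivity
  have hq := Real.quadratic_le_exp_of_nonneg hx
  have he : Real.exp (-(r ^ 2 / 2)) ≤ (1 + r ^ 2 / 2 + (r ^ 2 / 2) ^ 2 / 2)⁻¹ := by
    rw [Real.exp_neg]
    exact inv_anti₀ (by positivity) hq
  have hi : (1 + r ^ 2 / 2 + (r ^ 2 / 2) ^ 2 / 2)⁻¹ ≤ 1 - 3 / 8 * r ^ 2 := by
    rw [inv_le_iff_one_le_mul₀ (by positivity)]
    nlinarith [mul_nonneg h.le (sub_nonneg.2 h1), mul_nonneg (mul_nonneg h.le h.le) (sub_nonneg.2 h1)]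
  linarith

theorem exp_le_one_add_add_sq_mul (x : ℝ) :
    Real.exp x ≤ 1 + x + x ^ 2 * Real.exp |x| := by
  have h1 : 1 ≤ Real.exp |x| := Real.one_le_exp (abs_nonneg x)
  rcases le_or_gt |x| 1 with hx | hx
  · have := (abs_le.1 (Real.abs_exp_sub_one_sub_id_le hx)).2
    nlinarith [sq_nonneg x]
  · rcases le_total 0 x with h0 | h0
    · rw [abs_of_nonneg h0] at hx h1 ⊢
      have h2 : 1 ≤ x ^ 2 := one_le_pow₀ hx.le
      nlinarith [mul_nonneg (sub_nonneg.2 h2) (Real.exp_pos x).le]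
    · rw [abs_of_nonpos h0] at hx h1 ⊢
      have : Real.exp x ≤ 1 := Real.exp_le_one_iff.2 h0
      nlinarith

/-- The square root moves nonnegative numbers towards 1, so control of the squared ratio costs
nothing. -/
theorem sqrt_mem_Icc_of_mem_Icc {x ε : ℝ} (hε : 0 ≤ ε) (hε1 : ε ≤ 1)
    (hx : x ∈ Set.Icc (1 - ε) (1 + ε)) : √x ∈ Set.Icc (1 - ε) (1 + ε) := by
  constructor
  · refine Real.le_sqrt_of_sq_le (le_trans ?_ hx.1)
    nlinarith
  · rw [Real.sqrt_le_left (by linarith)]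
    nlinarith [hx.2]

/-! ### Reduction of the kernel distances to quotients in polar coordinates -/

theorem featureKernel_eq {d t : ℕ} (w : Fin t → EuclideanSpace ℝ (Fin d))
    (x y : EuclideanSpace ℝ (Fin d)) :
    featureKernel w x y = (∑ i, Real.cos (inner ℝ (w i) (x - y))) / t := by
  have h : √(t : ℝ) * √(t : ℝ) = t := Real.mul_self_sqrt (Nat.cast_nonneg t)
  simp only [featureKernel, featureMap, featurePair, PiLp.inner_apply, Fintype.sum_prod_type,
    Fin.sum_univ_two, Finset.sum_div, inner_sub_right, Real.cos_sub]
  refine Finset.sum_congr rfl fun i _ => ?_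
  simp
  rw [div_mul_div_comm, div_mul_div_comm, h]
  ring

theorem kernelDist_featureKernel {d t : ℕ} (w : Fin t → EuclideanSpace ℝ (Fin d))
    (ht : 0 < t) {σ r : ℝ} (hr : 0 < r) (x y u : EuclideanSpace ℝ (Fin d))
    (h : x - y = (σ * r) • u) :
    kernelDist (featureKernel w) x y =
      √(2 * r ^ 2 * ((∑ i, chordQuotient r (inner ℝ u (σ • w i))) / t)) := by
  have ht' : (t : ℝ) ≠ 0 := by positivity
  rw [kernelDist, featureKernel_eq, featureKernel_eq, featureKernel_eq, h]
  congr 1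
  simp only [chordQuotient, sub_self, inner_zero_right, Real.cos_zero, inner_smul_right,
    real_inner_smul_left, real_inner_comm _ u, ← Finset.sum_div, Finset.sum_sub_distrib]
  simp only [Finset.sum_const, Finset.card_univ, Fintype.card_fin, nsmul_eq_mul, mul_one]
  have : ∀ i, σ * r * inner ℝ (w i) u = r * (σ * inner ℝ (w i) u) := fun i => by ring
  simp only [this]
  field_simp
  ring

theorem kernelDist_gaussianKernel {d : ℕ} {σ r : ℝ} (hσ : σ ≠ 0) (hr : 0 < r)
    (x y u : EuclideanSpace ℝ (Fin d)) (hu : ‖u‖ = 1) (h : x - y = (σ * r) • u) :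
    kernelDist (gaussianKernel σ) x y = √(2 * r ^ 2 * gaussQuotient r) := by
  rw [kernelDist, gaussianKernel, gaussianKernel, gaussianKernel, h, gaussQuotient]
  congr 1
  have : ‖(σ * r) • u‖ ^ 2 / (2 * σ ^ 2) = r ^ 2 / 2 := by
    rw [norm_smul, hu, Real.norm_eq_abs, mul_one, sq_abs]
    field_simp
  rw [this]
  simp only [sub_self, norm_zero]
  field_simp
  norm_num
  ring

theorem kernelDist_ratio_mem_Icc {d t : ℕ} (w : Fin t → EuclideanSpace ℝ (Fin d)) (ht : 0 < t)
    {σ ε : ℝ} (hσ : 0 < σ) (hε : 0 ≤ ε) (hε1 : ε ≤ 1)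
    (h : ∀ r u, 0 < r → r ≤ 1 → ‖u‖ = 1 →
      |(∑ i, chordQuotient r (inner ℝ u (σ • w i))) / t - gaussQuotient r| ≤
        ε * gaussQuotient r)
    (x y : EuclideanSpace ℝ (Fin d)) (hxy : x ≠ y) (hn : ‖σ⁻¹ • (x - y)‖ ≤ 1) :
    kernelDist (featureKernel w) x y / kernelDist (gaussianKernel σ) x y ∈
      Set.Icc (1 - ε) (1 + ε) := by
  set v := σ⁻¹ • (x - y) with hv
  have hv0 : v ≠ 0 := smul_ne_zero (inv_ne_zero hσ.ne') (sub_ne_zero.2 hxy)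
  have hr : 0 < ‖v‖ := norm_pos_iff.2 hv0
  set u := ‖v‖⁻¹ • v with hu
  have hu1 : ‖u‖ = 1 := norm_smul_inv_norm hv0
  have hxyu : x - y = (σ * ‖v‖) • u := by
    rw [hu, smul_smul, mul_assoc, mul_inv_cancel₀ hr.ne', mul_one, hv, smul_smul,
      mul_inv_cancel₀ hσ.ne', one_smul]
  have hm : 0 < gaussQuotient ‖v‖ := lt_of_lt_of_le (by norm_num) (le_gaussQuotient hr hn)
  rw [kernelDist_featureKernel w ht hr x y u hxyu,
    kernelDist_gaussianKernel hσ.ne' hr x y u hu1 hxyu, ← Real.sqrt_div' _ (by positivity),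
    mul_div_mul_left _ _ (by positivity)]
  refine sqrt_mem_Icc_of_mem_Icc hε hε1 ?_
  have := abs_le.1 (h ‖v‖ u hr hn hu1)
  rw [Set.mem_Icc, le_div_iff₀ hm, div_le_iff₀ hm]
  constructor <;> linarith

/-! ### One-dimensional Gaussian moments -/

theorem gaussianPDFReal_mul_exp_sq (x : ℝ) :
    gaussianPDFReal 0 1 x * Real.exp (x ^ 2 / 4) =
      (√(2 * Real.pi))⁻¹ * Real.exp (-(1 / 4) * x ^ 2) := by
  rw [gaussianPDFReal_def, mul_assoc, ← Real.exp_add, NNReal.coe_one, mul_one, mul_one, sub_zero]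
  ring_nf

theorem integrable_exp_sq_gaussianReal :
    Integrable (fun x : ℝ => Real.exp (x ^ 2 / 4)) (gaussianReal 0 1) := by
  rw [gaussianReal_of_var_ne_zero _ one_ne_zero,
    integrable_withDensity_iff_integrable_smul' (measurable_gaussianPDF 0 1)
      (Filter.Eventually.of_forall fun _ => gaussianPDF_lt_top)]
  simp only [toReal_gaussianPDF, smul_eq_mul, gaussianPDFReal_mul_exp_sq]
  exact (integrable_exp_neg_mul_sq (by norm_num)).const_mul _

theorem integral_exp_sq_gaussianReal_le :
    ∫ x : ℝ, Real.exp (x ^ 2 / 4) ∂(gaussianReal 0 1) ≤ 3 / 2 := by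
  rw [integral_gaussianReal_eq_integral_smul one_ne_zero]
  simp only [smul_eq_mul, gaussianPDFReal_mul_exp_sq]
  rw [integral_const_mul, integral_gaussian]
  -- The exact value of the moment is √2.
  have h : √(Real.pi / (1 / 4)) = √2 * √(2 * Real.pi) := by
    rw [← Real.sqrt_mul (by norm_num)]
    ring_nf
  rw [h, mul_comm, mul_assoc, mul_inv_cancel₀ (by positivity), mul_one,
    Real.sqrt_le_left (by norm_num)]
  norm_num

theorem sq_le_mul_exp {y : ℝ} (hy : 0 ≤ y) : y ^ 2 ≤ 32 * Real.exp (y / 4) := by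
  have := Real.quadratic_le_exp_of_nonneg (x := y / 4) (by positivity)
  nlinarith

theorem integrable_pow_four_gaussianReal :
    Integrable (fun x : ℝ => x ^ 4) (gaussianReal 0 1) := by
  refine (integrable_exp_sq_gaussianReal.const_mul 32).mono' (by fun_prop)
    (Filter.Eventually.of_forall fun x => ?_)
  rw [Real.norm_of_nonneg (by positivity)]
  have := sq_le_mul_exp (sq_nonneg x)
  rwa [← pow_mul] at this

theorem integral_pow_four_gaussianReal_le :
    ∫ x : ℝ, x ^ 4 ∂(gaussianReal 0 1) ≤ 48 := by
  refine (integral_mono integrable_pow_four_gaussianReal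
    (integrable_exp_sq_gaussianReal.const_mul 32) fun x => ?_).trans ?_
  · have := sq_le_mul_exp (sq_nonneg x)
    rwa [← pow_mul] at this
  · rw [integral_const_mul]
    linarith [integral_exp_sq_gaussianReal_le]

theorem integrable_cos_gaussianReal (r : ℝ) :
    Integrable (fun x : ℝ => Real.cos (r * x)) (gaussianReal 0 1) := by
  refine (integrable_const (1 : ℝ)).mono' (by fun_prop)
    (Filter.Eventually.of_forall fun x => ?_)
  simpa using Real.abs_cos_le_one _

theorem integral_cos_gaussianReal (r : ℝ) :
    ∫ x : ℝ, Real.cos (r * x) ∂(gaussianReal 0 1) = Real.exp (-(r ^ 2 / 2)) := by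
  have h := charFun_gaussianReal (μ := 0) (v := 1) r
  rw [charFun_apply_real] at h
  have h2 := congrArg Complex.re h
  have hi : Integrable (fun x : ℝ => Complex.exp (r * x * Complex.I)) (gaussianReal 0 1) := by
    refine (integrable_const (1 : ℝ)).mono' (by fun_prop)
      (Filter.Eventually.of_forall fun x => ?_)
    rw [← Complex.ofReal_mul, Complex.norm_exp_ofReal_mul_I]
  have h3 : (∫ x : ℝ, Complex.exp (r * x * Complex.I) ∂(gaussianReal 0 1)).re =
      ∫ x : ℝ, (Complex.exp (r * x * Complex.I)).re ∂(gaussianReal 0 1) :=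
    (integral_re hi).symm
  rw [h3] at h2
  simp only [← Complex.ofReal_mul, Complex.exp_ofReal_mul_I_re] at h2
  rw [h2]
  have : (r * (0 : ℝ) * Complex.I - ((1 : NNReal) : ℝ) * (r : ℂ) ^ 2 / 2 : ℂ) =
      ((-(r ^ 2 / 2) : ℝ) : ℂ) := by
    push_cast
    simp
  rw [← Complex.exp_ofReal_re, ← this]
  simp

theorem integrable_chordQuotient (r : ℝ) :
    Integrable (chordQuotient r) (gaussianReal 0 1) :=
  ((integrable_const 1).sub (integrable_cos_gaussianReal r)).div_const _

theorem integral_chordQuotient (r : ℝ) :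
    ∫ s, chordQuotient r s ∂(gaussianReal 0 1) = gaussQuotient r := by
  simp only [chordQuotient, gaussQuotient]
  rw [integral_div, integral_sub (integrable_const 1) (integrable_cos_gaussianReal r),
    integral_cos_gaussianReal]
  simp

/-- The pointwise Lipschitz bound with s = s' and A = |s| is integrated; 98 = 2(1 + 48), where 48
bounds the fourth moment. -/
theorem abs_gaussQuotient_sub_le {r r' η : ℝ} (hr : 0 < r) (hr1 : r ≤ 1) (hr' : 0 < r')
    (hrr : |r - r'| ≤ η) : |gaussQuotient r - gaussQuotient r'| ≤ 98 * η := by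
  have hη : 0 ≤ η := (abs_nonneg _).trans hrr
  rw [← integral_chordQuotient, ← integral_chordQuotient,
    ← integral_sub (integrable_chordQuotient r) (integrable_chordQuotient r')]
  refine (abs_integral_le_integral_abs).trans ?_
  have hint : Integrable (fun s : ℝ => 2 * η * (1 + s ^ 4)) (gaussianReal 0 1) :=
    ((integrable_const 1).add integrable_pow_four_gaussianReal).const_mul _
  refine (integral_mono ((integrable_chordQuotient r).sub (integrable_chordQuotient r')).abs
    hint fun s => ?_).trans ?_
  · have := abs_chordQuotient_sub_le (s := s) (s' := s) hr hr1 hr' le_rfl le_rfl hη hrr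
      (by simpa using by positivity)
    rwa [pow_abs, abs_of_nonneg (by positivity : (0 : ℝ) ≤ s ^ 4)] at this
  · rw [integral_const_mul, integral_add (integrable_const 1) integrable_pow_four_gaussianReal]
    have := integral_pow_four_gaussianReal_le
    simp only [integral_const, probReal_univ, smul_eq_mul, mul_one]
    nlinarith

/-! ### Exponential moments and the tail at a fixed point -/

theorem exp_quarter_le : Real.exp (1 / 4) ≤ 4 / 3 := by
  have h := Real.add_one_le_exp (-(1 / 4) : ℝ)
  rw [Real.exp_neg] at h
  have hp := Real.exp_pos (1 / 4)
  have h2 : Real.exp (1 / 4) * (Real.exp (1 / 4))⁻¹ = 1 := mul_inv_cancel₀ hp.ne'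
  nlinarith

/-- With y = (s² + 1)/2, the factors x² and e^|lx| cost 32 e^(y/4) and e^(y/4). Their product is a
multiple of e^(s²/4), which is still Gaussian integrable. -/
theorem exp_mul_le_of_abs_le {l x s : ℝ} (hl : |l| ≤ 1 / 4) (hx : |x| ≤ (s ^ 2 + 1) / 2) :
    Real.exp (l * x) ≤ 1 + l * x + l ^ 2 * (128 / 3 * Real.exp (s ^ 2 / 4)) := by
  set y := (s ^ 2 + 1) / 2 with hy
  have hy0 : 0 ≤ y := by positivity
  refine (exp_le_one_add_add_sq_mul _).trans ?_
  rw [mul_pow, mul_assoc]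
  refine add_le_add le_rfl (mul_le_mul_of_nonneg_left ?_ (sq_nonneg l))
  have h1 : x ^ 2 ≤ y ^ 2 := sq_le_sq' (abs_le.1 hx).1 (abs_le.1 hx).2
  have h2 : |l * x| ≤ y / 4 := by
    rw [abs_mul]
    nlinarith [mul_le_mul hl hx (abs_nonneg x) (by norm_num)]
  calc x ^ 2 * Real.exp |l * x| ≤ (32 * Real.exp (y / 4)) * Real.exp (y / 4) := by
        gcongr
        exact h1.trans (sq_le_mul_exp hy0)
    _ = 32 * (Real.exp (1 / 4) * Real.exp (s ^ 2 / 4)) := by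
        rw [mul_assoc, ← Real.exp_add, ← Real.exp_add]
        congr 2
        rw [hy]
        ring
    _ ≤ 32 * (4 / 3 * Real.exp (s ^ 2 / 4)) := by
        gcongr
        exact exp_quarter_le
    _ = _ := by ring

/-- Integration kills the linear term because f is centred, and 64 = (128/3)(3/2). -/
theorem mgf_le_of_abs_le_sq {f : ℝ → ℝ} (hf : Measurable f)
    (hfs : ∀ s, |f s| ≤ (s ^ 2 + 1) / 2) (hf0 : ∫ s, f s ∂(gaussianReal 0 1) = 0)
    (hfi : Integrable f (gaussianReal 0 1)) {l : ℝ} (hl : |l| ≤ 1 / 4) :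
    mgf f (gaussianReal 0 1) l ≤ Real.exp (64 * l ^ 2) ∧
      Integrable (fun s => Real.exp (l * f s)) (gaussianReal 0 1) := by
  have hb : Integrable (fun s => 1 + l * f s + l ^ 2 * (128 / 3 * Real.exp (s ^ 2 / 4)))
      (gaussianReal 0 1) :=
    ((integrable_const 1).add (hfi.const_mul l)).add
      ((integrable_exp_sq_gaussianReal.const_mul _).const_mul _)
  have hle := fun s => exp_mul_le_of_abs_le hl (hfs s)
  have hint : Integrable (fun s => Real.exp (l * f s)) (gaussianReal 0 1) := by
    refine hb.mono' (by fun_prop) (Filter.Eventually.of_forall fun s => ?_)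
    rw [Real.norm_of_nonneg (Real.exp_pos _).le]
    exact hle s
  refine ⟨(integral_mono hint hb hle).trans ?_, hint⟩
  rw [integral_add (f := fun s => 1 + l * f s) ((integrable_const 1).add (hfi.const_mul l))
      ((integrable_exp_sq_gaussianReal.const_mul _).const_mul _),
    integral_add (integrable_const 1) (hfi.const_mul l), integral_const_mul, integral_const_mul,
    integral_const_mul, hf0]
  simp only [integral_const, probReal_univ, smul_eq_mul, mul_one, mul_zero, add_zero]
  have := integral_exp_sq_gaussianReal_le
  refine le_trans ?_ (Real.add_one_le_exp _)
  nlinarith [sq_nonneg l]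

theorem measureReal_sum_ge_le {Ω : Type*} [MeasurableSpace Ω] {μ : Measure Ω}
    [IsProbabilityMeasure μ] {t : ℕ} {s : Fin t → Ω → ℝ}
    (hs : ∀ i, HasLaw (s i) (gaussianReal 0 1) μ) (hind : iIndepFun s μ)
    {f : ℝ → ℝ} (hf : Measurable f) (hfs : ∀ x, |f x| ≤ (x ^ 2 + 1) / 2)
    (hf0 : ∫ x, f x ∂(gaussianReal 0 1) = 0) (hfi : Integrable f (gaussianReal 0 1))
    {η : ℝ} (hη : 0 ≤ η) (hη1 : η ≤ 1) :
    μ.real {a | t * η ≤ ∑ i, f (s i a)} ≤ Real.exp (-(t * η ^ 2 / 256)) := by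
  -- The choice l = η/128 minimises the Chernoff exponent 64 l² - lη.
  have hl : |η / 128| ≤ 1 / 4 := by
    rw [abs_of_nonneg (by positivity)]
    linarith
  obtain ⟨hm, hi⟩ := mgf_le_of_abs_le_sq hf hfs hf0 hfi hl
  have hms : ∀ i, mgf (f ∘ s i) μ (η / 128) = mgf f (gaussianReal 0 1) (η / 128) := fun i =>
    (hs i).integral_comp (f := fun x => Real.exp (η / 128 * f x)) (by fun_prop)
  have hsum := (hind.comp (fun _ => f) fun _ => hf).mgf_sum₀ (t := η / 128)
    (fun i => hf.comp_aemeasurable (hs i).aemeasurable) Finset.univ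
  have hpos : 0 < mgf f (gaussianReal 0 1) (η / 128) := mgf_pos hi
  simp only [hms, Finset.prod_const, Finset.card_univ, Fintype.card_fin] at hsum
  have hint : Integrable (fun a => Real.exp (η / 128 * (∑ i, f ∘ s i) a)) μ := by
    -- A non-integrable exponential would have integral 0 by convention, but the product of the
    -- individual mgfs is positive.
    by_contra hcon
    rw [mgf, integral_undef hcon] at hsum
    exact (pow_pos hpos t).ne hsum
  have hch := measure_ge_le_exp_mul_mgf (μ := μ) (X := ∑ i, f ∘ s i) (t * η)
    (t := η / 128) (by positivity) hint
  rw [hsum] at hch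
  simp only [Finset.sum_apply, Function.comp_apply] at hch
  refine hch.trans ?_
  calc _ ≤ Real.exp (-(η / 128) * (t * η)) * Real.exp (64 * (η / 128) ^ 2) ^ t := by
        gcongr
    _ = _ := by
        rw [← Real.exp_nat_mul, ← Real.exp_add]
        congr 1
        ring

theorem measureReal_abs_avg_chordQuotient_sub_ge_le {Ω : Type*} [MeasurableSpace Ω]
    {μ : Measure Ω} [IsProbabilityMeasure μ] {t : ℕ} (ht : 0 < t) {s : Fin t → Ω → ℝ}
    (hs : ∀ i, HasLaw (s i) (gaussianReal 0 1) μ) (hind : iIndepFun s μ)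
    {r : ℝ} (hr : r ≠ 0) {η : ℝ} (hη : 0 ≤ η) (hη1 : η ≤ 1) :
    μ.real {a | η ≤ |(∑ i, chordQuotient r (s i a)) / t - gaussQuotient r|} ≤
      2 * Real.exp (-(t * η ^ 2 / 256)) := by
  have htp : (0 : ℝ) < t := by positivity
  have hg0 : 0 ≤ gaussQuotient r := by
    rw [← integral_chordQuotient]
    exact integral_nonneg (chordQuotient_nonneg r)
  have hb : ∀ x, |chordQuotient r x - gaussQuotient r| ≤ (x ^ 2 + 1) / 2 := fun x => by
    have h1 := chordQuotient_nonneg r x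
    have h2 := chordQuotient_le hr x
    have h3 := gaussQuotient_le hr
    rw [abs_le]
    constructor <;> nlinarith
  have hm : Measurable fun x => chordQuotient r x - gaussQuotient r :=
    (measurable_chordQuotient r).sub_const _
  have hi : Integrable (fun x => chordQuotient r x - gaussQuotient r) (gaussianReal 0 1) :=
    (integrable_chordQuotient r).sub (integrable_const _)
  have h0 : ∫ x, (chordQuotient r x - gaussQuotient r) ∂(gaussianReal 0 1) = 0 := by
    rw [integral_sub (integrable_chordQuotient r) (integrable_const _), integral_chordQuotient]
    simp
  have hup := measureReal_sum_ge_le hs hind hm hb h0 hi hη hη1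
  have hlo := measureReal_sum_ge_le hs hind hm.neg (fun x => by simpa [abs_sub_comm] using hb x)
    (by simpa only [Pi.neg_apply, integral_neg, neg_eq_zero] using h0) hi.neg hη hη1
  have hsub : {a | η ≤ |(∑ i, chordQuotient r (s i a)) / t - gaussQuotient r|} ⊆
      {a | t * η ≤ ∑ i, (chordQuotient r (s i a) - gaussQuotient r)} ∪
        {a | t * η ≤ ∑ i, (-fun x => chordQuotient r x - gaussQuotient r) (s i a)} := by
    intro a ha
    simp only [Set.mem_ofPred_eq, Set.mem_union, Pi.neg_apply, Finset.sum_neg_distrib,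
      Finset.sum_sub_distrib, Finset.sum_const, Finset.card_univ, Fintype.card_fin,
      nsmul_eq_mul] at ha ⊢
    have hX : ∑ i, chordQuotient r (s i a) = t * ((∑ i, chordQuotient r (s i a)) / t) := by
      field_simp
    rw [hX, ← mul_sub, ← mul_neg]
    rcases le_abs.1 ha with h | h
    · exact Or.inl (mul_le_mul_of_nonneg_left h htp.le)
    · exact Or.inr (mul_le_mul_of_nonneg_left h htp.le)
  calc _ ≤ _ := measureReal_mono hsub
    _ ≤ _ := measureReal_union_le _ _
    _ ≤ _ := by linarith

/-! ### A net in polar coordinates -/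

theorem exists_polar_net {d : ℕ} (hd : 1 ≤ d) {η : ℝ} (hη : 0 < η) (hη1 : η ≤ 1) :
    ∃ T : Finset (ℝ × EuclideanSpace ℝ (Fin d)),
      (T.card : ℝ) ≤ (5 * d / η) ^ (d + 1) ∧
      (∀ p ∈ T, 0 < p.1 ∧ p.1 ≤ 1 ∧ ‖p.2‖ = 1) ∧
      ∀ (r : ℝ) (u : EuclideanSpace ℝ (Fin d)), 0 < r → r ≤ 1 → ‖u‖ = 1 →
        ∃ p ∈ T, |r - p.1| ≤ η ∧ ‖u - p.2‖ ≤ η := by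
  classical
  have hd' : (1 : ℝ) ≤ d := by exact_mod_cast hd
  -- Mesh η/d in each coordinate gives Euclidean error at most √d · η/d ≤ η.
  set h := η / d with hh
  have hh0 : 0 < h := by positivity
  have hhη : h ≤ η := div_le_self hη.le hd'
  set N : ℕ := ⌈1 / h⌉₊ with hN
  let S : Set (ℝ × EuclideanSpace ℝ (Fin d)) := {p | 0 < p.1 ∧ p.1 ≤ 1 ∧ ‖p.2‖ = 1}
  let q : ℝ × EuclideanSpace ℝ (Fin d) → Fin (d + 1) → ℤ :=
    fun p => Fin.cons ⌊p.1 / h⌋ fun j => ⌊p.2 j / h⌋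
  let B : Finset (Fin (d + 1) → ℤ) := Fintype.piFinset fun _ => Finset.Icc (-(N : ℤ)) N
  have : Nonempty (ℝ × EuclideanSpace ℝ (Fin d)) := ⟨0⟩
  have hfloor : ∀ x : ℝ, |x| ≤ 1 → ⌊x / h⌋ ∈ Finset.Icc (-(N : ℤ)) N := by
    intro x hx
    have h1 : |x / h| ≤ N := by
      rw [abs_div, abs_of_pos hh0]
      exact (div_le_div_of_nonneg_right hx hh0.le).trans (Nat.le_ceil _)
    rw [Finset.mem_Icc, Int.le_floor]
    refine ⟨by push_cast; exact (abs_le.1 h1).1, ?_⟩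
    exact_mod_cast (Int.floor_le (x / h)).trans (abs_le.1 h1).2
  have hqB : ∀ p ∈ S, q p ∈ B := by
    rintro ⟨r, u⟩ ⟨hr, hr1, hu⟩
    rw [Fintype.mem_piFinset]
    refine Fin.cases ?_ fun j => ?_
    · exact hfloor r (by rwa [abs_of_pos hr])
    · exact hfloor (u j) (hu ▸ PiLp.norm_apply_le u j)
  have hclose : ∀ x y : ℝ, ⌊x / h⌋ = ⌊y / h⌋ → |x - y| ≤ h := by
    intro x y hxy
    have := (Int.abs_sub_lt_one_of_floor_eq_floor hxy).le
    rwa [← sub_div, abs_div, abs_of_pos hh0, div_le_one hh0] at this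
  -- One representative is chosen in each grid cell meeting S, so that net points have unit
  -- direction and positive radius, as grid points need not.
  refine ⟨(B.filter (· ∈ q '' S)).image (Function.invFunOn q S), ?_, ?_, ?_⟩
  · have hcard : ((B.filter (· ∈ q '' S)).image (Function.invFunOn q S)).card ≤
        (2 * N + 1) ^ (d + 1) := by
      refine Finset.card_image_le.trans ((Finset.card_filter_le _ _).trans ?_)
      rw [Fintype.card_piFinset]
      simp only [Int.card_Icc, Finset.prod_const, Finset.card_univ, Fintype.card_fin]
      refine Nat.pow_le_pow_left ?_ _
      omega
    have hN' : (N : ℝ) ≤ 1 / h + 1 := (Nat.ceil_lt_add_one (by positivity)).le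
    have hinv : 1 / h = d / η := by rw [hh, one_div_div]
    have h1 : 1 ≤ d / η := by rw [le_div_iff₀ hη]; linarith
    calc _ ≤ ((2 * N + 1 : ℝ)) ^ (d + 1) := by exact_mod_cast hcard
      _ ≤ (5 * d / η) ^ (d + 1) := by
        gcongr
        rw [mul_div_assoc]
        linarith
  · intro p hp
    obtain ⟨k, hk, rfl⟩ := Finset.mem_image.1 hp
    exact Function.invFunOn_mem (Finset.mem_filter.1 hk).2
  · intro r u hr hr1 hu
    have hS : (r, u) ∈ S := ⟨hr, hr1, hu⟩
    have him : q (r, u) ∈ q '' S := ⟨_, hS, rfl⟩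
    refine ⟨_, Finset.mem_image.2 ⟨q (r, u), Finset.mem_filter.2 ⟨hqB _ hS, him⟩, rfl⟩, ?_⟩
    have heq : q (Function.invFunOn q S (q (r, u))) = q (r, u) := Function.invFunOn_eq him
    set p := Function.invFunOn q S (q (r, u))
    refine ⟨(hclose _ _ (congrFun heq 0).symm).trans hhη, ?_⟩
    have hj : ∀ j, |(u - p.2) j| ≤ h := fun j => hclose _ _ (congrFun heq j.succ).symm
    rw [EuclideanSpace.norm_eq, Real.sqrt_le_left hη.le]
    have hdh : d * h = η := by rw [hh]; field_simp
    calc ∑ j, ‖(u - p.2) j‖ ^ 2 ≤ ∑ _j : Fin d, h ^ 2 := by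
          gcongr with j
          exact hj j
      _ = d * h ^ 2 := by simp
      _ ≤ (d * h) ^ 2 := by
          rw [mul_pow]
          gcongr
          nlinarith
      _ = η ^ 2 := by rw [hdh]

/-! ### Gaussian laws and fourth moments in ℝᵈ -/

theorem hasLaw_inner_stdGaussian {d : ℕ} {u : EuclideanSpace ℝ (Fin d)} (hu : ‖u‖ = 1) :
    HasLaw (fun x => inner ℝ u x) (gaussianReal 0 1)
      (stdGaussian (EuclideanSpace ℝ (Fin d))) where
  map_eq := by
    have h := IsGaussian.map_eq_gaussianReal (μ := stdGaussian (EuclideanSpace ℝ (Fin d)))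
      (innerSL ℝ u)
    rw [integral_strongDual_stdGaussian, variance_dual_stdGaussian, innerSL_apply_norm, hu,
      one_pow, Real.toNNReal_one] at h
    exact h

theorem hasLaw_smul_multivariateGaussian {d : ℕ} {σ : ℝ} (hσ : σ ≠ 0) :
    HasLaw (fun x => σ • x) (stdGaussian (EuclideanSpace ℝ (Fin d)))
      (multivariateGaussian 0 ((σ ^ 2)⁻¹ • (1 : Matrix (Fin d) (Fin d) ℝ))) where
  map_eq := by
    have hS : ((σ ^ 2)⁻¹ • (1 : Matrix (Fin d) (Fin d) ℝ)).PosSemidef :=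
      Matrix.PosSemidef.one.smul (by positivity)
    have : IsProbabilityMeasure ((multivariateGaussian 0
        ((σ ^ 2)⁻¹ • (1 : Matrix (Fin d) (Fin d) ℝ))).map fun x => σ • x) :=
      Measure.isProbabilityMeasure_map (by fun_prop)
    refine Measure.ext_of_charFun (funext fun v => ?_)
    have hv : (σ • v).ofLp ⬝ᵥ ((σ ^ 2)⁻¹ • (1 : Matrix (Fin d) (Fin d) ℝ)).mulVec (σ • v).ofLp =
        ‖v‖ ^ 2 := by
      rw [EuclideanSpace.real_norm_sq_eq, Matrix.smul_mulVec, Matrix.one_mulVec]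
      simp only [dotProduct, PiLp.smul_apply, Pi.smul_apply, smul_eq_mul]
      refine Finset.sum_congr rfl fun j _ => ?_
      field_simp
    rw [charFun_map_smul, charFun_multivariateGaussian hS, charFun_stdGaussian, hv]
    simp [neg_div]

theorem integrable_norm_pow_four_stdGaussian_and_le (d : ℕ) :
    Integrable (fun x => ‖x‖ ^ 4) (stdGaussian (EuclideanSpace ℝ (Fin d))) ∧
      ∫ x, ‖x‖ ^ 4 ∂(stdGaussian (EuclideanSpace ℝ (Fin d))) ≤ 48 * (d : ℝ) ^ 2 := by
  have hlaw : ∀ j : Fin d, HasLaw (fun x : EuclideanSpace ℝ (Fin d) => x j) (gaussianReal 0 1)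
      (stdGaussian (EuclideanSpace ℝ (Fin d))) := fun j => by
    have := hasLaw_inner_stdGaussian (u := EuclideanSpace.single j (1 : ℝ)) (by simp)
    simpa [EuclideanSpace.inner_single_left] using this
  have hint : ∀ j : Fin d, Integrable (fun x : EuclideanSpace ℝ (Fin d) => x j ^ 4)
      (stdGaussian (EuclideanSpace ℝ (Fin d))) := fun j => by
    have h := integrable_pow_four_gaussianReal
    rw [← (hlaw j).map_eq] at h
    exact h.comp_aemeasurable (hlaw j).aemeasurable
  have hle : ∀ x : EuclideanSpace ℝ (Fin d), ‖x‖ ^ 4 ≤ d * ∑ j, x j ^ 4 := fun x => by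
    have h := sq_sum_le_card_mul_sum_sq (s := Finset.univ) (f := fun j => x j ^ 2)
    rw [← EuclideanSpace.real_norm_sq_eq] at h
    simpa [← pow_mul] using h
  have hb : Integrable (fun x : EuclideanSpace ℝ (Fin d) => d * ∑ j, x j ^ 4)
      (stdGaussian (EuclideanSpace ℝ (Fin d))) :=
    (integrable_finsetSum _ fun j _ => hint j).const_mul _
  have hi : Integrable (fun x => ‖x‖ ^ 4) (stdGaussian (EuclideanSpace ℝ (Fin d))) := by
    refine hb.mono' (by fun_prop) (Filter.Eventually.of_forall fun x => ?_)
    rw [Real.norm_of_nonneg (by positivity)]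
    exact hle x
  refine ⟨hi, (integral_mono hi hb hle).trans ?_⟩
  rw [integral_const_mul, integral_finsetSum _ fun j _ => hint j]
  have h4 : ∀ j : Fin d, ∫ x, x j ^ 4 ∂(stdGaussian (EuclideanSpace ℝ (Fin d))) ≤ 48 := fun j => by
    have := (hlaw j).integral_comp (f := fun x : ℝ => x ^ 4) (by fun_prop)
    exact this.le.trans integral_pow_four_gaussianReal_le
  calc _ ≤ (d : ℝ) * ∑ _j : Fin d, (48 : ℝ) := by
        gcongr with j
        exact h4 j
    _ = _ := by
        simp
        ring

/-! ### Markov's inequality, the net and the union bound -/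

section UniformBound

variable {Ω : Type*} [MeasurableSpace Ω] {μ : Measure Ω} [IsProbabilityMeasure μ]

theorem measureReal_avg_pow_four_ge_le {d t : ℕ} (hd : 1 ≤ d) (ht : 0 < t) {δ : ℝ} (hδ : 0 < δ)
    {g : Fin t → Ω → EuclideanSpace ℝ (Fin d)}
    (hg : ∀ i, HasLaw (g i) (stdGaussian (EuclideanSpace ℝ (Fin d))) μ) :
    μ.real {a | 98 * (d : ℝ) ^ 2 / δ ≤ (∑ i, (1 + ‖g i a‖ ^ 4)) / t} ≤ δ / 2 := by
  have htp : (0 : ℝ) < t := by positivity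
  have hd' : (1 : ℝ) ≤ d := by exact_mod_cast hd
  obtain ⟨hi, hle⟩ := integrable_norm_pow_four_stdGaussian_and_le d
  have hint : ∀ i, Integrable (fun a => 1 + ‖g i a‖ ^ 4) μ := fun i => by
    have h := hi
    rw [← (hg i).map_eq] at h
    exact (integrable_const 1).add (h.comp_aemeasurable (hg i).aemeasurable)
  have hE : ∀ i, ∫ a, (1 + ‖g i a‖ ^ 4) ∂μ ≤ 49 * (d : ℝ) ^ 2 := fun i => by
    have h : ∫ a, (1 + ‖g i a‖ ^ 4) ∂μ = _ :=
      (hg i).integral_comp (f := fun x => 1 + ‖x‖ ^ 4) (by fun_prop)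
    rw [h, integral_add (integrable_const 1) hi]
    simp only [integral_const, probReal_univ, smul_eq_mul, mul_one]
    nlinarith
  have hm := mul_meas_ge_le_integral_of_nonneg (μ := μ)
    (f := fun a => (∑ i, (1 + ‖g i a‖ ^ 4)) / t)
    (Filter.Eventually.of_forall fun a => by positivity)
    ((integrable_finsetSum _ fun i _ => hint i).div_const _) (98 * (d : ℝ) ^ 2 / δ)
  rw [integral_div, integral_finsetSum _ fun i _ => hint i] at hm
  have hsum : (∑ i, ∫ a, (1 + ‖g i a‖ ^ 4) ∂μ) / t ≤ 49 * (d : ℝ) ^ 2 := by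
    rw [div_le_iff₀ htp]
    refine (Finset.sum_le_sum fun i _ => hE i).trans ?_
    simp [mul_comm]
  have h2 := hm.trans hsum
  rw [div_mul_eq_mul_div, div_le_iff₀ hδ] at h2
  have hd2 : (0 : ℝ) < 49 * (d : ℝ) ^ 2 := by positivity
  rw [le_div_iff₀ two_pos]
  refine le_of_mul_le_mul_left ?_ hd2
  linarith

theorem abs_avg_chordQuotient_sub_le {d t : ℕ} (ht : 0 < t) (g : Fin t → EuclideanSpace ℝ (Fin d))
    {r r' η : ℝ} {u u' : EuclideanSpace ℝ (Fin d)} (hr : 0 < r) (hr1 : r ≤ 1) (hr' : 0 < r')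
    (hu : ‖u‖ = 1) (hu' : ‖u'‖ = 1) (hrr : |r - r'| ≤ η) (huu : ‖u - u'‖ ≤ η) :
    |(∑ i, chordQuotient r (inner ℝ u (g i))) / t -
      (∑ i, chordQuotient r' (inner ℝ u' (g i))) / t| ≤
      2 * η * ((∑ i, (1 + ‖g i‖ ^ 4)) / t) := by
  have htp : (0 : ℝ) < t := by positivity
  have hη : 0 ≤ η := (abs_nonneg _).trans hrr
  rw [← sub_div, ← Finset.sum_sub_distrib, abs_div, abs_of_pos htp, ← mul_div_assoc,
    Finset.mul_sum]
  gcongr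
  refine (Finset.abs_sum_le_sum_abs _ _).trans (Finset.sum_le_sum fun i _ => ?_)
  refine abs_chordQuotient_sub_le hr hr1 hr' ?_ ?_ hη hrr ?_
  · simpa [hu] using abs_real_inner_le_norm u (g i)
  · simpa [hu'] using abs_real_inner_le_norm u' (g i)
  · rw [← inner_sub_left]
    exact (abs_real_inner_le_norm _ _).trans (by gcongr)

/-- The features with frequencies `g` reproduce the normalised Gaussian kernel distance up to the
relative error `ε`, uniformly over the punctured unit ball in polar coordinates. -/
def UniformlyClose {d t : ℕ} (ε : ℝ) (g : Fin t → EuclideanSpace ℝ (Fin d)) : Prop :=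
  ∀ (r : ℝ) (u : EuclideanSpace ℝ (Fin d)), 0 < r → r ≤ 1 → ‖u‖ = 1 →
    |(∑ i, chordQuotient r (inner ℝ u (g i))) / t - gaussQuotient r| ≤ ε * gaussQuotient r

/-- With Q = d/(εδ) ≥ 2, every factor is compared with a power of Q. The net has at most Q^(16(d+1))
points, the constant 4 and 1/δ cost Q³, and 16(d+1) + 3 ≤ 35d. Then 573440 = 35 · 64 · 256 makes the
tail at most Q^(-35d). -/
theorem card_mul_exp_le {d t : ℕ} {ε δ : ℝ} (hd : 1 ≤ d) (hε : 0 < ε) (hε1 : ε < 1) (hδ : 0 < δ)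
    (hδ1 : δ < 1) (hQ : 2 ≤ (d : ℝ) / ε * (1 / δ))
    (ht : 573440 * ((d : ℝ) / ε ^ 2 * Real.log ((d : ℝ) / ε * (1 / δ))) ≤ (t : ℝ)) :
    (5 * d / (ε * δ / (1568 * d ^ 2))) ^ (d + 1) *
      (2 * Real.exp (-(t * (ε / 8) ^ 2 / 256))) ≤ δ / 2 := by
  have hd' : (1 : ℝ) ≤ d := by exact_mod_cast hd
  set Q := (d : ℝ) / ε * (1 / δ) with hQdef
  have hQ0 : 0 < Q := by linarith
  have hQ1 : 1 ≤ Q := by linarith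
  have hεδ : ε * δ ≤ 1 := by nlinarith
  have hεδ0 : 0 < ε * δ := by positivity
  have hQ' : Q * (ε * δ) = d := by rw [hQdef]; field_simp
  have hδQ : 1 ≤ Q * δ := by
    have : Q * δ * ε = d := by rw [← hQ']; ring
    nlinarith [mul_pos hQ0 hδ]
  have hbase : 5 * d / (ε * δ / (1568 * d ^ 2)) ≤ Q ^ 16 := by
    have h13 : (7840 : ℝ) ≤ Q ^ 13 := by
      calc (7840 : ℝ) ≤ 2 ^ 13 := by norm_num
        _ ≤ Q ^ 13 := by gcongr
    have h3 : (d : ℝ) ^ 3 / (ε * δ) ≤ Q ^ 3 := by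
      rw [div_le_iff₀ hεδ0, ← hQ', mul_pow]
      have : (ε * δ) ^ 3 ≤ ε * δ := by
        calc (ε * δ) ^ 3 ≤ (ε * δ) ^ 1 := pow_le_pow_of_le_one hεδ0.le hεδ (by norm_num)
          _ = ε * δ := pow_one _
      gcongr
    calc 5 * d / (ε * δ / (1568 * d ^ 2)) = 7840 * ((d : ℝ) ^ 3 / (ε * δ)) := by
          field_simp
          ring
      _ ≤ Q ^ 13 * Q ^ 3 := by gcongr
      _ = Q ^ 16 := by ring
  have hexp : Real.exp (-(t * (ε / 8) ^ 2 / 256)) ≤ (Q ^ (35 * d))⁻¹ := by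
    rw [← Real.exp_log (pow_pos hQ0 (35 * d)), ← Real.exp_neg, Real.log_pow]
    gcongr
    have h1 : 573440 * ((d : ℝ) / ε ^ 2 * Real.log Q) * ε ^ 2 = 573440 * (d * Real.log Q) := by
      field_simp
    have h2 := mul_le_mul_of_nonneg_right ht (sq_nonneg ε)
    rw [h1] at h2
    push_cast
    linarith
  have hpow : (Q ^ 16) ^ (d + 1) * 4 ≤ Q ^ (35 * d) * δ := by
    have h4 : (4 : ℝ) ≤ Q ^ 2 := by nlinarith
    calc (Q ^ 16) ^ (d + 1) * 4 ≤ (Q ^ 16) ^ (d + 1) * (Q ^ 2 * (Q * δ)) := by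
          gcongr
          nlinarith
      _ = Q ^ (16 * (d + 1) + 3) * δ := by rw [← pow_mul, pow_add]; ring
      _ ≤ Q ^ (35 * d) * δ := by
          gcongr
          omega
  calc _ ≤ (Q ^ 16) ^ (d + 1) * (2 * (Q ^ (35 * d))⁻¹) := by gcongr
    _ = (Q ^ 16) ^ (d + 1) * 4 * (Q ^ (35 * d))⁻¹ / 2 := by ring
    _ ≤ Q ^ (35 * d) * δ * (Q ^ (35 * d))⁻¹ / 2 := by gcongr
    _ = δ / 2 := by
        field_simp

theorem measureReal_not_uniformlyClose_le {d t : ℕ} {ε δ : ℝ} (hd : 1 ≤ d) (hε : 0 < ε)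
    (hε1 : ε < 1) (hδ : 0 < δ) (hδ1 : δ < 1) (hQ : 2 ≤ (d : ℝ) / ε * (1 / δ))
    (ht : 573440 * ((d : ℝ) / ε ^ 2 * Real.log ((d : ℝ) / ε * (1 / δ))) ≤ (t : ℝ)) (ht0 : 0 < t)
    {g : Fin t → Ω → EuclideanSpace ℝ (Fin d)}
    (hg : ∀ i, HasLaw (g i) (stdGaussian (EuclideanSpace ℝ (Fin d))) μ) (hind : iIndepFun g μ) :
    μ.real {a | UniformlyClose ε fun i => g i a}ᶜ ≤ δ := by
  have hd' : (1 : ℝ) ≤ d := by exact_mod_cast hd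
  -- The mesh solves 2η · 98d²/δ = ε/8, so 1568 = 16 · 98.
  set η := ε * δ / (1568 * (d : ℝ) ^ 2) with hη
  have hη0 : 0 < η := by positivity
  have hd2 : (1 : ℝ) ≤ (d : ℝ) ^ 2 := one_le_pow₀ hd'
  have hηd : 1568 * (d : ℝ) ^ 2 * η = ε * δ := by rw [hη]; field_simp
  have hηε : 1568 * η ≤ ε := by
    have : 1568 * η * 1 ≤ 1568 * η * (d : ℝ) ^ 2 := by gcongr
    nlinarith
  obtain ⟨T, hTcard, hTmem, hTnet⟩ := exists_polar_net hd hη0 (by linarith)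
  set A : Set Ω := {a | 98 * (d : ℝ) ^ 2 / δ ≤ (∑ i, (1 + ‖g i a‖ ^ 4)) / t} with hA
  let E : ℝ × EuclideanSpace ℝ (Fin d) → Set Ω := fun p =>
    {a | ε / 8 ≤ |(∑ i, chordQuotient p.1 (inner ℝ p.2 (g i a))) / t - gaussQuotient p.1|}
  have hE : ∀ p ∈ T, μ.real (E p) ≤ 2 * Real.exp (-(t * (ε / 8) ^ 2 / 256)) := by
    intro p hp
    obtain ⟨hp0, hp1, hpu⟩ := hTmem p hp
    exact measureReal_abs_avg_chordQuotient_sub_ge_le ht0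
      (fun i => (hasLaw_inner_stdGaussian hpu).fun_comp (hg i))
      (hind.comp (fun _ x => inner ℝ p.2 x) fun _ => by fun_prop) hp0.ne'
      (by positivity) (by linarith)
  have hsub : {a | UniformlyClose ε fun i => g i a}ᶜ ⊆ A ∪ ⋃ p ∈ T, E p := by
    rw [Set.compl_subset_comm]
    intro a ha
    simp only [Set.compl_union, Set.compl_iUnion, Set.mem_inter_iff, Set.mem_iInter,
      Set.mem_compl_iff, hA, E, Set.mem_ofPred_eq, not_le] at ha
    intro r u hr hr1 hu
    obtain ⟨p, hpT, hrp, hup⟩ := hTnet r u hr hr1 hu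
    obtain ⟨hp0, hp1, hpu⟩ := hTmem p hpT
    have h1 := abs_avg_chordQuotient_sub_le ht0 (fun i => g i a) hr hr1 hp0 hu hpu hrp hup
    have h2 := ha.2 p hpT
    have h3 := abs_gaussQuotient_sub_le hr hr1 hp0 hrp
    have h4 : 2 * η * ((∑ i, (1 + ‖g i a‖ ^ 4)) / t) ≤ ε / 8 := by
      have : 2 * η * (98 * (d : ℝ) ^ 2 / δ) = ε / 8 := by
        rw [hη]
        field_simp
        norm_num
      rw [← this]
      exact mul_le_mul_of_nonneg_left ha.1.le (by positivity)
    have h5 := le_gaussQuotient hr hr1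
    have h6 : ε * (3 / 8) ≤ ε * gaussQuotient r := by gcongr
    rw [abs_le] at h1 h3 ⊢
    rw [abs_lt] at h2
    -- Error budget: ε/8 from moving the average to the net, ε/8 from concentration, and 98η ≤ ε/16
    -- from moving the mean; the sum is below 3ε/8 ≤ ε · `gaussQuotient r`.
    constructor <;> linarith [h1.1, h1.2, h2.1, h2.2, h3.1, h3.2]
  calc _ ≤ μ.real (A ∪ ⋃ p ∈ T, E p) := measureReal_mono hsub
    _ ≤ μ.real A + μ.real (⋃ p ∈ T, E p) := measureReal_union_le _ _
    _ ≤ δ / 2 + ∑ p ∈ T, μ.real (E p) :=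
        add_le_add (measureReal_avg_pow_four_ge_le hd ht0 hδ hg)
          (measureReal_biUnion_finset_le _ _)
    _ ≤ δ / 2 + ∑ _p ∈ T, 2 * Real.exp (-(t * (ε / 8) ^ 2 / 256)) := by
        gcongr with p hp
        exact hE p hp
    _ ≤ δ / 2 + δ / 2 := by
        rw [Finset.sum_const, nsmul_eq_mul]
        gcongr
        refine le_trans ?_ (card_mul_exp_le hd hε hε1 hδ hδ1 hQ ht)
        gcongr
    _ = δ := by ring

/-! ### The degenerate range d/(εδ) < 2 -/

theorem UniformlyClose.mono {d t : ℕ} {ε ε' : ℝ} {g : Fin t → EuclideanSpace ℝ (Fin d)}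
    (h : UniformlyClose ε g) (hε : ε ≤ ε') : UniformlyClose ε' g := fun r u hr hr1 hu =>
  (h r u hr hr1 hu).trans <| by
    have := le_gaussQuotient hr hr1
    gcongr

/-- In dimension one u = ±1, so a frequency of modulus in [9/10, 1] puts each chord quotient in
[1/4, 1/2] at every radius. Since the mean lies in [3/8, 1/2], relative error 1/2 holds
deterministically. -/
theorem uniformlyClose_half_of_mem_Icc {t : ℕ} (ht : 0 < t)
    {g : Fin t → EuclideanSpace ℝ (Fin 1)}
    (h : ∀ i, inner ℝ (EuclideanSpace.single 0 1) (g i) ∈ Set.Icc (9 / 10 : ℝ) 1) :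
    UniformlyClose (1 / 2) g := by
  intro r u hr hr1 hu
  have htp : (0 : ℝ) < t := by positivity
  have hu2 : u 0 ^ 2 = 1 := by
    have := EuclideanSpace.real_norm_sq_eq u
    simpa [hu] using this.symm
  have hi : ∀ i, chordQuotient r (inner ℝ u (g i)) ∈ Set.Icc (1 / 4 : ℝ) (1 / 2) := by
    intro i
    obtain ⟨h1, h2⟩ := h i
    rw [EuclideanSpace.inner_single_left] at h1 h2
    simp only [map_one, one_mul] at h1 h2
    have hs : (inner ℝ u (g i) : ℝ) ^ 2 = g i 0 ^ 2 := by
      simp [PiLp.inner_apply, mul_pow, hu2]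
    set s : ℝ := inner ℝ u (g i)
    have hs1 : s ^ 2 ≤ 1 := by rw [hs]; nlinarith
    have hs2 : 81 / 100 ≤ s ^ 2 := by rw [hs]; nlinarith
    have hr2 : r ^ 2 ≤ 1 := pow_le_one₀ hr.le hr1
    have hr0 : 0 < r ^ 2 := by positivity
    constructor
    · have habs : |r * s| ≤ 1 := by
        rw [← sq_le_one_iff_abs_le_one, mul_pow]
        exact mul_le_one₀ hr2 (sq_nonneg _) hs1
      have hc := (abs_le.1 (Real.cos_bound habs)).2
      rw [chordQuotient, le_div_iff₀ hr0]
      have h4 : |r * s| ^ 4 = r ^ 2 * (r ^ 2 * (s ^ 2 * s ^ 2)) := by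
        rw [show |r * s| ^ 4 = (|r * s| ^ 2) ^ 2 by ring, sq_abs]
        ring
      have h5 : r ^ 2 * (s ^ 2 * s ^ 2) ≤ 1 :=
        mul_le_one₀ hr2 (by positivity) (mul_le_one₀ hs1 (sq_nonneg _) hs1)
      rw [h4, mul_pow] at hc
      nlinarith [mul_le_mul_of_nonneg_left h5 hr0.le, mul_le_mul_of_nonneg_left hs2 hr0.le]
    · exact (chordQuotient_le hr.ne' s).trans (by linarith)
  have hlo : (1 / 4 : ℝ) ≤ (∑ i, chordQuotient r (inner ℝ u (g i))) / t := by
    rw [le_div_iff₀ htp]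
    have := Finset.card_nsmul_le_sum Finset.univ _ _ fun i _ => (hi i).1
    simpa [mul_comm] using this
  have hup : (∑ i, chordQuotient r (inner ℝ u (g i))) / t ≤ 1 / 2 := by
    rw [div_le_iff₀ htp]
    have := Finset.sum_le_card_nsmul Finset.univ _ _ fun i _ => (hi i).2
    simpa [mul_comm] using this
  have h1 := gaussQuotient_le hr.ne'
  have h2 := le_gaussQuotient hr hr1
  rw [abs_le]
  constructor <;> linarith

theorem gaussianReal_Icc_pos : 0 < (gaussianReal 0 1).real (Set.Icc (9 / 10 : ℝ) 1) := by
  refine lt_of_le_of_ne measureReal_nonneg fun h => ?_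
  replace h := (measureReal_eq_zero_iff).1 h.symm
  have := gaussianReal_absolutelyContinuous' 0 one_ne_zero h
  rw [Real.volume_Icc] at this
  norm_num at this

theorem pow_le_measureReal_uniformlyClose_half {t : ℕ} (ht : 0 < t)
    {g : Fin t → Ω → EuclideanSpace ℝ (Fin 1)}
    (hg : ∀ i, HasLaw (g i) (stdGaussian (EuclideanSpace ℝ (Fin 1))) μ) (hind : iIndepFun g μ) :
    (gaussianReal 0 1).real (Set.Icc (9 / 10 : ℝ) 1) ^ t ≤
      μ.real {a | UniformlyClose (1 / 2) fun i => g i a} := by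
  have hlaw : ∀ i, HasLaw (fun a => inner ℝ (EuclideanSpace.single (0 : Fin 1) (1 : ℝ)) (g i a))
      (gaussianReal 0 1) μ := fun i => (hasLaw_inner_stdGaussian (by simp)).fun_comp (hg i)
  have hind' := hind.comp (fun _ x => inner ℝ (EuclideanSpace.single (0 : Fin 1) (1 : ℝ)) x)
    fun _ => by fun_prop
  have h := hind'.measure_inter_preimage_eq_mul Finset.univ
    (sets := fun _ => Set.Icc (9 / 10 : ℝ) 1) fun _ _ => measurableSet_Icc
  have hp : ∀ i, μ (((fun x => inner ℝ (EuclideanSpace.single (0 : Fin 1) (1 : ℝ)) x) ∘ g i) ⁻¹'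
      Set.Icc (9 / 10 : ℝ) 1) = gaussianReal 0 1 (Set.Icc (9 / 10 : ℝ) 1) := fun i =>
    (hlaw i).measure_eq (p := (· ∈ Set.Icc (9 / 10 : ℝ) 1)) measurableSet_Icc
  simp only [hp, Finset.prod_const, Finset.card_univ, Fintype.card_fin] at h
  rw [measureReal_def, ← ENNReal.toReal_pow, ← h]
  refine measureReal_mono fun a ha => ?_
  simp only [Finset.mem_univ, Set.iInter_true, Set.mem_iInter] at ha
  exact uniformlyClose_half_of_mem_Icc ht ha

/-- Only subadditivity is used, so the uniform event need not be shown measurable. -/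
theorem one_sub_le_measureReal {s : Set Ω} {δ : ℝ} (h : μ.real sᶜ ≤ δ) : 1 - δ ≤ μ.real s := by
  have := measureReal_union_le (μ := μ) s sᶜ
  rw [Set.union_compl_self, probReal_univ] at this
  linarith

end UniformBound

/-! ### Choice of the absolute constant and conclusion -/

theorem exists_const_one_sub_le_measureReal_uniformlyClose :
    ∃ C : ℝ, 0 < C ∧ ∀ (d t : ℕ) (ε δ : ℝ), 1 ≤ d → 0 < ε → ε < 1 → 0 < δ → δ < 1 →
      C * ((d : ℝ) / ε ^ 2 * Real.log ((d : ℝ) / ε * (1 / δ))) ≤ (t : ℝ) → 0 < t ∧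
      ∀ (Ω : Type*) [MeasurableSpace Ω] (μ : Measure Ω) [IsProbabilityMeasure μ]
        (g : Fin t → Ω → EuclideanSpace ℝ (Fin d)),
        (∀ i, HasLaw (g i) (stdGaussian (EuclideanSpace ℝ (Fin d))) μ) → iIndepFun g μ →
        1 - δ ≤ μ.real {a | UniformlyClose ε fun i => g i a} := by
  set p := (gaussianReal 0 1).real (Set.Icc (9 / 10 : ℝ) 1)
  have hp : 0 < p := gaussianReal_Icc_pos
  -- N is the sample size sufficient for d = 1 and ε = δ = 1/2. The summand N / p^N in the constant
  -- serves only the case t < N.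
  set N : ℕ := ⌈573440 * ((1 : ℝ) / (1 / 2) ^ 2 * Real.log (1 / (1 / 2) * (1 / (1 / 2))))⌉₊ with hN
  refine ⟨573440 + N / p ^ N, by positivity, fun d t ε δ hd hε hε1 hδ hδ1 ht => ?_⟩
  have hd' : (1 : ℝ) ≤ d := by exact_mod_cast hd
  have hεδ0 : 0 < ε * δ := by positivity
  have hQ' : (d : ℝ) / ε * (1 / δ) = d / (ε * δ) := by field_simp
  have hQ1 : 1 < (d : ℝ) / ε * (1 / δ) := by
    rw [hQ', lt_div_iff₀ hεδ0]
    nlinarith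
  have hL : 0 < Real.log ((d : ℝ) / ε * (1 / δ)) := Real.log_pos hQ1
  have hX : 0 < (d : ℝ) / ε ^ 2 * Real.log ((d : ℝ) / ε * (1 / δ)) := by positivity
  have ht0 : 0 < t := by
    have : (0 : ℝ) < t := lt_of_lt_of_le (by positivity) ht
    exact_mod_cast this
  refine ⟨ht0, fun Ω _ μ _ g hg hind => ?_⟩
  have hNp : 0 ≤ N / p ^ N := by positivity
  rcases le_or_gt 2 ((d : ℝ) / ε * (1 / δ)) with hQ | hQ
  · exact one_sub_le_measureReal (measureReal_not_uniformlyClose_le hd hε hε1 hδ hδ1 hQ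
      (by nlinarith) ht0 hg hind)
  have hlt : (d : ℝ) < 2 * (ε * δ) := by rwa [hQ', div_lt_iff₀ hεδ0] at hQ
  have hd1 : d = 1 := by
    have : (d : ℝ) < 2 := by nlinarith
    have : d < 2 := by exact_mod_cast this
    omega
  subst hd1
  push_cast at *
  have hε2 : 1 / 2 ≤ ε := by nlinarith
  have hδ2 : 1 / 2 ≤ δ := by nlinarith
  have hmono : μ.real {a | UniformlyClose (1 / 2) fun i => g i a} ≤
      μ.real {a | UniformlyClose ε fun i => g i a} :=
    measureReal_mono fun a ha => UniformlyClose.mono ha hε2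
  refine le_trans ?_ hmono
  rcases le_or_gt N t with hNt | hNt
  · have hNt' : (N : ℝ) ≤ t := by exact_mod_cast hNt
    have := one_sub_le_measureReal (measureReal_not_uniformlyClose_le (δ := 1 / 2) (ε := 1 / 2)
      le_rfl (by norm_num) (by norm_num) (by norm_num) (by norm_num) (by norm_num)
      (by push_cast; exact (Nat.le_ceil _).trans hNt') ht0 hg hind)
    linarith
  -- Here t < N. The lower bound on t gives (N / p^N) ℓ ≤ t ≤ N, so 1 - δ ≤ -log δ ≤ ℓ ≤ p^N ≤ p^t.
  · refine le_trans ?_ (pow_le_measureReal_uniformlyClose_half ht0 hg hind)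
    have hp1 : p ≤ 1 := measureReal_le_one
    have hpt : p ^ N ≤ p ^ t := pow_le_pow_of_le_one hp.le hp1 hNt.le
    refine le_trans ?_ hpt
    set ℓ := Real.log (1 / ε * (1 / δ)) with hℓ
    have h1 : 1 - δ ≤ ℓ := by
      have h2 : ℓ = -Real.log ε - Real.log δ := by
        rw [hℓ, Real.log_mul (by positivity) (by positivity), one_div, one_div, Real.log_inv,
          Real.log_inv]
        ring
      linarith [Real.log_le_sub_one_of_pos hδ, Real.log_neg hε hε1]
    have h2 : ℓ ≤ 1 / ε ^ 2 * ℓ := by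
      refine le_mul_of_one_le_left hL.le ?_
      rw [le_div_iff₀ (by positivity)]
      nlinarith
    have hNt' : (t : ℝ) ≤ N := by exact_mod_cast hNt.le
    have h3 : N / p ^ N * ℓ ≤ N := by
      calc N / p ^ N * ℓ ≤ (573440 + N / p ^ N) * (1 / ε ^ 2 * ℓ) := by
            gcongr
            linarith
        _ ≤ t := ht
        _ ≤ N := hNt'
    have hN0 : (0 : ℝ) < N := by
      have : 0 < N := by omega
      exact_mod_cast this
    have h4 : ℓ ≤ p ^ N := by
      rw [div_mul_eq_mul_div, div_le_iff₀ (by positivity)] at h3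
      exact le_of_mul_le_mul_left h3 hN0
    linarith

theorem mainTheorem8 :
    ∃ C : ℝ, 0 < C ∧
      ∀ (d t : ℕ) (ε δ σ : ℝ), 1 ≤ d → 0 < ε → ε < 1 → 0 < δ → δ < 1 → 0 < σ →
        C * ((d : ℝ) / ε ^ 2 * Real.log ((d : ℝ) / ε * (1 / δ))) ≤ (t : ℝ) →
        ∀ (Ω : Type*) [MeasurableSpace Ω] (μ : MeasureTheory.Measure Ω)
          [MeasureTheory.IsProbabilityMeasure μ]
          (w : Fin t → Ω → EuclideanSpace ℝ (Fin d)),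
          (∀ i, ProbabilityTheory.HasLaw (w i)
            (ProbabilityTheory.multivariateGaussian 0
              ((σ ^ 2)⁻¹ • (1 : Matrix (Fin d) (Fin d) ℝ))) μ) →
          ProbabilityTheory.iIndepFun w μ →
          1 - δ ≤ μ.real {a | ∀ x y : EuclideanSpace ℝ (Fin d),
            x ≠ y → ‖σ⁻¹ • (x - y)‖ ≤ 1 →
            kernelDist (featureKernel fun i => w i a) x y / kernelDist (gaussianKernel σ) x y
              ∈ Set.Icc (1 - ε) (1 + ε)} := by
  obtain ⟨C, hC, h⟩ := exists_const_one_sub_le_measureReal_uniformlyClose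
  refine ⟨C, hC, fun d t ε δ σ hd hε hε1 hδ hδ1 hσ ht Ω _ μ _ w hw hind => ?_⟩
  obtain ⟨ht0, h⟩ := h d t ε δ hd hε hε1 hδ hδ1 ht
  refine (h Ω μ (fun i a => σ • w i a)
    (fun i => (hasLaw_smul_multivariateGaussian hσ.ne').fun_comp (hw i))
    (hind.comp (fun _ x => σ • x) fun _ => by fun_prop)).trans
    (MeasureTheory.measureReal_mono fun a ha x y hxy hn => ?_)
  exact kernelDist_ratio_mem_Icc (fun i => w i a) ht0 hσ hε.le hε1.le ha x y hxy hn
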